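/- For a bounded function $u:\mathbb R\to\mathbb C$, let $$(-\Delta)^{1/2}u(x)=\frac1\pi\,\mathrm{p.v.}\!\int_{-\infty}^{\infty}\frac{u(x)-u(x+y)}{|y|^{2}}\,dy$$ denote the half Laplacian, that is, the case $\alpha=1$ of $(-\Delta)^{\alpha/2}u(x)=c_\alpha\,\mathrm{p.v.}\!\int_{-\infty}^\infty\frac{u(x)-u(x+y)}{|y|^{1+\alpha}}dy$ with $c_\alpha=\alpha\frac{2^{\alpha-1}\Gamma(1/2+\alpha/2)}{\sqrt\pi\,\Gamma(1-\alpha/2)}$. Let $\operatorname{acot}:\mathbb R\to(0,\pi)$ be the inverse cotangent, and let ${}_2F_1(a,b;c;z)=\sum_{n=0}^\infty\frac{(a)_n(b)_n}{(c)_n}\frac{z^n}{n!}$ be the Gaussian hypergeometric series. Let $k$ be an odd integer, $L>0$, $s\in(0,\pi)$, and $x=L\cot(s)\Longleftrightarrow s=\operatorname{acot}(x/L)$. Then the half Laplacian of the function $y\mapsto e^{ik\operatorname{acot}(y/L)}$ exists at the point $x$ and equals $$-\frac{2i}{L\pi(k+2)}-\frac kL\sin^2(s)e^{iks}+\frac{8i\,{}_2F_1(1,-k/2-1;-k/2+2;e^{2is})}{L\pi(4-k^2)},$$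 where the hypergeometric series converges absolutely, and it also equals $$-\frac{2i\,\operatorname{sgn}(k)}{L\pi(|k|+2)}-\frac{2ik}{L\pi}e^{iks}\left[\cos(s)+\sin^2(s)\ln\left(\cot\left(\frac s2\right)\right)+\sum_{n=0}^{(|k|-1)/2}\frac{4e^{-i\operatorname{sgn}(k)(2n+1)s}}{(2n-1)(2n+1)(2n+3)}\right].$$ Furthermore, when $L=1$, both forms are expressed in terms of $x$ as follows: for every $x\in\mathbb R$, the half Laplacian of $y\mapsto\frac{(y+i)^k}{(y^2+1)^{k/2}}$ exists at $x$ and equals $$-\frac{2i}{\pi(k+2)}-\frac{k(x+i)^k}{(x^2+1)^{k/2+1}}+\frac{8i}{\pi(4-k^2)}\,{}_2F_1\left(1,-\frac k2-1;-\frac k2+2;\frac{(x+i)^2}{x^2+1}\right)$$ (again with an absolutely convergent series), and it also equals $$-\frac{2i\,\operatorname{sgn}(k)}{\pi(|k|+2)}-\frac{2ik(x+i)^k\left[x(x^2+1)^{1/2}+\operatorname{arsinh}(x)\right]}{\pi(x^2+1)^{k/2+1}}-\sum_{n=0}^{(|k|-1)/2}\frac{8ik(x+i)^{k-\operatorname{sgn}(k)(2n+1)}}{\pi(2n-1)(2n+1)(2n+3)(x^2+1)^{[k-\operatorname{sgn}(k)(2n+1)]/2}}.$$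 -/

import Mathlib

open Filter Topology MeasureTheory

namespace HalfLap

noncomputable section

/-- The inverse cotangent with values in `(0, π)`. -/
def acot (t : ℝ) : ℝ := Real.pi / 2 - Real.arctan t

/-- The normalizing constant `c_α` of the fractional Laplacian `(-Δ)^{α/2}` on the real line. -/
def fracLapConst (α : ℝ) : ℝ :=
  α * ((2 : ℝ) ^ (α - 1) * Real.Gamma (1 / 2 + α / 2)) /
    (Real.sqrt Real.pi * Real.Gamma (1 - α / 2))

/-- The integrand `(u(x) - u(x+y)) / |y|^{1+α}`. -/
def fracLapIntegrand (α : ℝ) (u : ℝ → ℂ) (x y : ℝ) : ℂ :=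
  (u x - u (x + y)) / ((|y| ^ (1 + α) : ℝ) : ℂ)

/-- `HasFracLaplacianAt α u x v`: the fractional Laplacian `(-Δ)^{α/2} u` exists at `x`, as the
principal value integral `c_α · p.v. ∫ (u(x) - u(x+y)) / |y|^{1+α} dy`, and equals `v`. -/
def HasFracLaplacianAt (α : ℝ) (u : ℝ → ℂ) (x : ℝ) (v : ℂ) : Prop :=
  (∀ ε : ℝ, 0 < ε → IntegrableOn (fracLapIntegrand α u x) {y : ℝ | ε < |y|}) ∧
  Tendsto
    (fun ε : ℝ => (fracLapConst α : ℂ) * ∫ y in {y : ℝ | ε < |y|}, fracLapIntegrand α u x y)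
    (𝓝[>] 0) (𝓝 v)

/-- The half Laplacian `(-Δ)^{1/2} u` exists at `x` and equals `v`. -/
def HasHalfLaplacianAt (u : ℝ → ℂ) (x : ℝ) (v : ℂ) : Prop :=
  HasFracLaplacianAt 1 u x v

/-- The `n`-th term of the Gaussian hypergeometric series `₂F₁(1, -k/2-1; -k/2+2; z)`. -/
def hypTerm (k : ℤ) (z : ℂ) (n : ℕ) : ℂ :=
  ordinaryHypergeometricSeries ℂ (1 : ℂ) (-(k : ℂ) / 2 - 1) (-(k : ℂ) / 2 + 2) n (fun _ => z)

end

end HalfLap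

/-!
Put `s = acot x` and `θ = acot (x + y) - s`. Then the principal value to compute is that of
`(1 - exp (i k θ)) / y²`, multiplied by `exp (i k s)`. Its second difference in `k` with step `2`
is `4 exp (i k θ) sin² θ / y²`, and `sin² θ = y² sin² s / (1 + (x + y)²)`, so the singularity at
`y = 0` cancels. As `dθ = -dy / (1 + (x + y)²)`, this second difference has an elementary integral,
and for `k = ±1` the integrand itself has the primitive `tan (θ / 2) ∓ i log (tan (θ / 2))` up to
a constant factor. Odd `k` are therefore reached by induction in both directions.

The hypergeometric series is, up to a factor, the sum of `exp (i j s) / ((j - 2) j (j + 2))` over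
`j = -k, -k + 2, -k + 4, …`. The sums for `k` and `k - 2` differ by a single term, and this gives
the same recurrence for the claimed value. The weights are second differences of `1 / j`, so for
`j = 1, 3, 5, …` the sum is expressed through the boundary value of `log ((1 + z) / (1 - z))` at
`z = exp (i s)`, whence the term `log (cot (s / 2))`; for the other odd starting indices the finite
sum of the closed form makes up the difference.
-/

namespace HalfLap

open Set
open Complex (I)
open scoped Real

section PrincipalValue

variable {E : Type*} [NormedAddCommGroup E] {f g h : ℝ → E} {a b c v w : E}

theorem measurableSet_setOf_lt_abs (ε : ℝ) : MeasurableSet {y : ℝ | ε < |y|} :=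
  measurableSet_lt measurable_const measurable_norm

theorem setOf_lt_abs_eq_union (ε : ℝ) : {y : ℝ | ε < |y|} = Iio (-ε) ∪ Ioi ε := by
  ext y
  rw [mem_ofPred_eq, lt_abs, lt_neg, or_comm]
  rfl

theorem integrableOn_of_norm_le_div_sq {C : ℝ} (hm : AEStronglyMeasurable f)
    (hb : ∀ y, ‖f y‖ ≤ C / y ^ 2) {ε : ℝ} (hε : 0 < ε) : IntegrableOn f {y : ℝ | ε < |y|} := by
  have h_right : IntegrableOn (fun y : ℝ => C / y ^ 2) (Ioi ε) := by
    have h_rpow : IntegrableOn (fun y : ℝ => C * y ^ (-2 : ℝ)) (Ioi ε) :=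
      (integrableOn_Ioi_rpow_of_lt (by norm_num) hε).const_mul C
    refine h_rpow.congr_fun (fun y hy => ?_) measurableSet_Ioi
    simp only [Real.rpow_neg (hε.trans hy).le, Real.rpow_ofNat, div_eq_mul_inv]
  have h_left : IntegrableOn (fun y : ℝ => C / y ^ 2) (Iio (-ε)) := by
    rw [← integrable_indicator_iff measurableSet_Iio]
    refine ((integrable_indicator_iff measurableSet_Ioi).2 h_right).comp_neg.congr
      (ae_of_all _ fun y => ?_)
    simp only [indicator, mem_Iio, mem_Ioi, lt_neg, neg_sq]
  have h_union : IntegrableOn (fun y : ℝ => C / y ^ 2) {y : ℝ | ε < |y|} :=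
    setOf_lt_abs_eq_union ε ▸ h_left.union h_right
  exact h_union.mono' hm.restrict (ae_of_all _ hb)

variable [NormedSpace ℝ E]

/-- `HasPV f v`: the function `f` is integrable away from `0`, and `v` is the principal value at `0`
of its integral over the real line. -/
def HasPV (f : ℝ → E) (v : E) : Prop :=
  (∀ ε : ℝ, 0 < ε → IntegrableOn f {y : ℝ | ε < |y|}) ∧
  Tendsto (fun ε : ℝ => ∫ y in {y : ℝ | ε < |y|}, f y) (𝓝[>] 0) (𝓝 v)

namespace HasPV

theorem add (hf : HasPV f v) (hg : HasPV g w) : HasPV (f + g) (v + w) := by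
  refine ⟨fun ε hε => (hf.1 ε hε).add (hg.1 ε hε), (hf.2.add hg.2).congr' ?_⟩
  filter_upwards [self_mem_nhdsWithin] with ε hε
  exact (integral_add (hf.1 ε hε) (hg.1 ε hε)).symm

theorem const_smul {𝕜 : Type*} [NormedField 𝕜] [NormedSpace 𝕜 E] [SMulCommClass ℝ 𝕜 E]
    (r : 𝕜) (hf : HasPV f v) : HasPV (r • f) (r • v) :=
  ⟨fun ε hε => (hf.1 ε hε).smul r,
    (hf.2.const_smul r).congr fun _ => (integral_smul r f).symm⟩

theorem congr (hf : HasPV f v) (h : ∀ y, y ≠ 0 → f y = g y) : HasPV g v := by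
  have h_eqOn : ∀ ε : ℝ, 0 < ε → EqOn f g {y : ℝ | ε < |y|} := fun ε hε y hy =>
    h y (abs_pos.1 (hε.trans hy))
  refine ⟨fun ε hε => (hf.1 ε hε).congr_fun (h_eqOn ε hε) (measurableSet_setOf_lt_abs ε),
    hf.2.congr' ?_⟩
  filter_upwards [self_mem_nhdsWithin] with ε hε
  exact setIntegral_congr_fun (measurableSet_setOf_lt_abs ε) (h_eqOn ε hε)

theorem comp_div (hf : HasPV f v) {L : ℝ} (hL : 0 < L) :
    HasPV (fun y => f (y / L)) (L • v) := by
  have h_indicator : ∀ ε : ℝ, {y : ℝ | ε < |y|}.indicator (fun y => f (y / L)) =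
      fun y => {y : ℝ | ε / L < |y|}.indicator f (y / L) := by
    intro ε
    ext y
    simp only [indicator, mem_ofPred_eq, abs_div, abs_of_pos hL, div_lt_div_iff_of_pos_right hL]
  constructor
  · intro ε hε
    rw [← integrable_indicator_iff (measurableSet_setOf_lt_abs ε), h_indicator]
    exact ((integrable_indicator_iff (measurableSet_setOf_lt_abs _)).2
      (hf.1 (ε / L) (div_pos hε hL))).comp_div hL.ne'
  · have h_scale : Tendsto (fun ε : ℝ => ε / L) (𝓝[>] 0) (𝓝[>] 0) := by
      refine tendsto_nhdsWithin_iff.2 ⟨?_, ?_⟩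
      · exact ((continuous_id.div_const L).tendsto' 0 0 (zero_div L)).mono_left nhdsWithin_le_nhds
      · filter_upwards [self_mem_nhdsWithin] with ε hε using div_pos hε hL
    refine ((hf.2.comp h_scale).const_smul L).congr fun ε => ?_
    rw [Function.comp_apply, ← integral_indicator (measurableSet_setOf_lt_abs ε), h_indicator,
      ← integral_indicator (measurableSet_setOf_lt_abs _), Measure.integral_comp_div,
      abs_of_pos hL]

theorem of_second_difference (hg : HasPV g b) (hh : HasPV h c) (hw : HasPV f w)
    {e : ℝ → E} (he : ∀ y, y ≠ 0 → e y - (2 : ℝ) • g y + h y = f y)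
    (ha : a - (2 : ℝ) • b + c = w) : HasPV e a := by
  have h_sum := (hw.add (hg.const_smul (2 : ℝ))).add (hh.const_smul (-1 : ℝ))
  rw [show w + (2 : ℝ) • b + (-1 : ℝ) • c = a by rw [← ha]; module] at h_sum
  refine h_sum.congr fun y hy => ?_
  rw [Pi.add_apply, Pi.add_apply, Pi.smul_apply, Pi.smul_apply, ← he y hy]
  module

theorem of_hasDerivAt [CompleteSpace E] {F : ℝ → E}
    (hint : ∀ ε : ℝ, 0 < ε → IntegrableOn f {y : ℝ | ε < |y|})
    (hF : ∀ y, y ≠ 0 → HasDerivAt F (f y) y)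
    (hbot : Tendsto F atBot (𝓝 a)) (htop : Tendsto F atTop (𝓝 b))
    (hzero : Tendsto (fun ε => F ε - F (-ε)) (𝓝[>] 0) (𝓝 0)) : HasPV f (b - a) := by
  have h_lim := hzero.const_sub (b - a)
  rw [sub_zero] at h_lim
  refine ⟨hint, h_lim.congr' ?_⟩
  filter_upwards [self_mem_nhdsWithin] with ε (hε : 0 < ε)
  have h_int := hint ε hε
  rw [setOf_lt_abs_eq_union] at h_int ⊢
  have h_right : ∫ y in Ioi ε, f y = b - F ε :=
    integral_Ioi_of_hasDerivAt_of_tendsto (hF ε hε.ne').continuousAt.continuousWithinAt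
      (fun y hy => hF y (hε.trans hy).ne') h_int.right_of_union htop
  have h_left : ∫ y in Iio (-ε), f y = F (-ε) - a := by
    rw [← integral_Iic_eq_integral_Iio]
    exact integral_Iic_of_hasDerivAt_of_tendsto
      (hF (-ε) (neg_ne_zero.2 hε.ne')).continuousAt.continuousWithinAt
      (fun y hy => hF y (hy.trans (neg_neg_of_pos hε)).ne)
      ((integrableOn_Iic_iff_integrableOn_Iio (by finiteness)).2 h_int.left_of_union) hbot
  have h_disjoint : Disjoint (Iio (-ε)) (Ioi ε) :=
    (Iio_disjoint_Ici le_rfl).mono_right (Ioi_subset_Ici (neg_le_self hε.le))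
  rw [setIntegral_union h_disjoint measurableSet_Ioi h_int.left_of_union h_int.right_of_union,
    h_left, h_right]
  abel

end HasPV

theorem tendsto_log_sub_log_neg {φ : ℝ → ℝ} {d : ℝ} (hφ : HasDerivAt φ d 0) (h0 : φ 0 = 0)
    (hd : d ≠ 0) :
    Tendsto (fun ε => Real.log (φ ε) - Real.log (φ (-ε))) (𝓝[>] 0) (𝓝 0) := by
  have h_slope : Tendsto (fun y => Real.log (φ y / y)) (𝓝[≠] 0) (𝓝 (Real.log d)) := by
    refine Tendsto.log ?_ hd
    simpa [h0, div_eq_inv_mul] using hφ.tendsto_slope_zero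
  have h_right : 𝓝[>] (0 : ℝ) ≤ 𝓝[≠] 0 := nhdsGT_le_nhdsNE 0
  have h_neg : Tendsto (fun ε : ℝ => -ε) (𝓝[>] 0) (𝓝[≠] 0) := by
    simpa using (tendsto_neg_nhdsGT (a := (0 : ℝ))).mono_right (nhdsLT_le_nhdsNE _)
  have h_diff := (h_slope.mono_left h_right).sub (h_slope.comp h_neg)
  rw [sub_self] at h_diff
  refine h_diff.congr' ?_
  have h_ne : ∀ᶠ y in 𝓝[≠] (0 : ℝ), φ y ≠ 0 := hφ.eventually_ne hd
  filter_upwards [h_right h_ne, h_neg.eventually h_ne, self_mem_nhdsWithin] with ε h₁ h₂ hε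
  have hε : ε ≠ 0 := (mem_Ioi.1 hε).ne'
  rw [Function.comp_apply, Real.log_div h₁ hε, Real.log_div h₂ (neg_ne_zero.2 hε),
    Real.log_neg_eq_log, sub_sub_sub_cancel_right]

end PrincipalValue

section HalfLaplacian

variable {u : ℝ → ℂ} {x : ℝ} {v : ℂ}

theorem fracLapConst_one : fracLapConst 1 = π⁻¹ := by
  rw [fracLapConst, show (1 / 2 + 1 / 2 : ℝ) = 1 by norm_num,
    show (1 - 1 / 2 : ℝ) = 1 / 2 by norm_num, Real.Gamma_one, Real.Gamma_one_half_eq, sub_self,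
    Real.rpow_zero, Real.mul_self_sqrt Real.pi_pos.le, one_mul, one_mul, one_div]

theorem fracLapIntegrand_one (u : ℝ → ℂ) (x y : ℝ) :
    fracLapIntegrand 1 u x y = (u x - u (x + y)) / y ^ 2 := by
  rw [fracLapIntegrand, show (1 + 1 : ℝ) = 2 by norm_num, Real.rpow_two, sq_abs,
    Complex.ofReal_pow]

theorem hasHalfLaplacianAt_iff_hasPV :
    HasHalfLaplacianAt u x v ↔ HasPV (fun y : ℝ => (u x - u (x + y)) / (y : ℂ) ^ 2) (π * v) := by
  have hpi : (π : ℂ) ≠ 0 := Complex.ofReal_ne_zero.2 Real.pi_ne_zero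
  simp only [HasHalfLaplacianAt, HasFracLaplacianAt, HasPV, ← fracLapIntegrand_one,
    fracLapConst_one, Complex.ofReal_inv]
  refine and_congr_right fun _ => ⟨fun h => ?_, fun h => ?_⟩
  · simpa only [mul_inv_cancel_left₀ hpi] using h.const_mul (π : ℂ)
  · simpa only [inv_mul_cancel_left₀ hpi] using h.const_mul (π : ℂ)⁻¹

theorem HasHalfLaplacianAt.comp_div {L : ℝ} (hL : 0 < L) (h : HasHalfLaplacianAt u (x / L) v) :
    HasHalfLaplacianAt (fun y => u (y / L)) x (v / L) := by
  have hL' : (L : ℂ) ≠ 0 := Complex.ofReal_ne_zero.2 hL.ne'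
  rw [hasHalfLaplacianAt_iff_hasPV] at h ⊢
  convert (h.comp_div hL).const_smul ((L : ℂ) ^ 2)⁻¹ using 1
  · ext y
    rw [Pi.smul_apply, smul_eq_mul, add_div, Complex.ofReal_div, div_pow]
    field_simp
  · rw [Complex.real_smul, smul_eq_mul]
    field_simp

end HalfLaplacian

section InverseCotangent

theorem sin_acot (x : ℝ) : Real.sin (acot x) = 1 / √(1 + x ^ 2) := by
  rw [acot, Real.sin_pi_div_two_sub, Real.cos_arctan]

theorem cos_acot (x : ℝ) : Real.cos (acot x) = x / √(1 + x ^ 2) := by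
  rw [acot, Real.cos_pi_div_two_sub, Real.sin_arctan]

theorem acot_mem_Ioo (x : ℝ) : acot x ∈ Ioo 0 π := by
  have h_lt := Real.arctan_lt_pi_div_two x
  have h_gt := Real.neg_pi_div_two_lt_arctan x
  rw [acot]
  constructor <;> linarith

theorem sin_acot_sq (x : ℝ) : Real.sin (acot x) ^ 2 = (1 + x ^ 2)⁻¹ := by
  rw [sin_acot, div_pow, Real.sq_sqrt (by positivity), one_pow, one_div]

theorem cot_acot (x : ℝ) : Real.cot (acot x) = x := by
  have h : √(1 + x ^ 2) ≠ 0 := by positivity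
  rw [Real.cot_eq_cos_div_sin, sin_acot, cos_acot]
  field_simp

theorem acot_cot {s : ℝ} (hs : s ∈ Ioo 0 π) : acot (Real.cot s) = s := by
  have h : Real.cot s = Real.tan (π / 2 - s) := by
    rw [Real.tan_pi_div_two_sub, Real.tan_eq_sin_div_cos, inv_div, Real.cot_eq_cos_div_sin]
  rw [acot, h, Real.arctan_tan] <;> linarith [hs.1, hs.2]

theorem eq_mul_cot_iff {L s x : ℝ} (hL : L ≠ 0) (hs : s ∈ Ioo 0 π) :
    x = L * Real.cot s ↔ s = acot (x / L) := by
  constructor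
  · rintro rfl
    rw [mul_div_cancel_left₀ _ hL, acot_cot hs]
  · rintro rfl
    rw [cot_acot, mul_div_cancel₀ _ hL]

theorem hasDerivAt_acot (x : ℝ) : HasDerivAt acot (-(1 + x ^ 2)⁻¹) x := by
  rw [← one_div]
  exact (Real.hasDerivAt_arctan x).const_sub (π / 2)

theorem continuous_acot : Continuous acot := continuous_const.sub Real.continuous_arctan

theorem tendsto_acot_atTop : Tendsto acot atTop (𝓝 0) := by
  rw [← sub_self (π / 2)]
  exact (Real.tendsto_arctan_atTop.mono_right nhdsWithin_le_nhds).const_sub (π / 2)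

theorem tendsto_acot_atBot : Tendsto acot atBot (𝓝 π) := by
  have h := (Real.tendsto_arctan_atBot.mono_right nhdsWithin_le_nhds).const_sub (π / 2)
  rwa [sub_neg_eq_add, add_halves] at h

/-- The increment of the inverse cotangent from `x` to `x + y`. As a function of `y` it is the
angular variable in which all the principal values below are computed. -/
noncomputable def acotDiff (x y : ℝ) : ℝ := acot (x + y) - acot x

variable (x : ℝ) {y : ℝ}

theorem acotDiff_zero : acotDiff x 0 = 0 := by rw [acotDiff, add_zero, sub_self]

theorem hasDerivAt_acotDiff (y : ℝ) : HasDerivAt (acotDiff x) (-(1 + (x + y) ^ 2)⁻¹) y :=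
  ((hasDerivAt_acot (x + y)).comp_const_add x y).sub_const _

theorem continuous_acotDiff : Continuous (acotDiff x) :=
  (continuous_acot.comp (continuous_const_add x)).sub continuous_const

theorem tendsto_acotDiff_atTop : Tendsto (acotDiff x) atTop (𝓝 (-acot x)) := by
  rw [← zero_sub]
  exact (tendsto_acot_atTop.comp (tendsto_atTop_add_const_left atTop x tendsto_id)).sub_const
    (acot x)

theorem tendsto_acotDiff_atBot : Tendsto (acotDiff x) atBot (𝓝 (π - acot x)) :=
  (tendsto_acot_atBot.comp (tendsto_atBot_add_const_left atBot x tendsto_id)).sub_const (acot x)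

theorem acotDiff_mem_Ioo (y : ℝ) : acotDiff x y ∈ Ioo (-π) π := by
  have h := acot_mem_Ioo x
  have h' := acot_mem_Ioo (x + y)
  rw [acotDiff]
  constructor <;> linarith [h.1, h.2, h'.1, h'.2]

theorem sin_acotDiff_sq (y : ℝ) :
    Real.sin (acotDiff x y) ^ 2 = y ^ 2 * Real.sin (acot x) ^ 2 * (1 + (x + y) ^ 2)⁻¹ := by
  have hx : √(1 + x ^ 2) ≠ 0 := by positivity
  have hxy : √(1 + (x + y) ^ 2) ≠ 0 := by positivity
  have h_sin : Real.sin (acotDiff x y) = -y / (√(1 + x ^ 2) * √(1 + (x + y) ^ 2)) := by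
    rw [acotDiff, Real.sin_sub, sin_acot, sin_acot, cos_acot, cos_acot]
    field_simp
    ring
  rw [h_sin, sin_acot_sq, div_pow, mul_pow, Real.sq_sqrt (by positivity),
    Real.sq_sqrt (by positivity), neg_sq, div_eq_mul_inv, mul_inv, mul_assoc]

theorem acotDiff_ne_zero (hy : y ≠ 0) : acotDiff x y ≠ 0 := by
  intro h
  have h_sq := sin_acotDiff_sq x y
  rw [h, Real.sin_zero, sin_acot_sq] at h_sq
  have h_pos : 0 < y ^ 2 * (1 + x ^ 2)⁻¹ * (1 + (x + y) ^ 2)⁻¹ := by positivity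
  exact h_pos.ne (by simpa using h_sq)

theorem HasPV.of_primitive_comp_acotDiff {E : Type*} [NormedAddCommGroup E] [NormedSpace ℝ E]
    [CompleteSpace E] {f g G : ℝ → E} {x : ℝ}
    (hint : ∀ ε : ℝ, 0 < ε → IntegrableOn f {y : ℝ | ε < |y|})
    (hf : ∀ y, y ≠ 0 → f y = (1 + (x + y) ^ 2)⁻¹ • g (acotDiff x y))
    (hG : ∀ θ ∈ Ioo (-π) π, θ ≠ 0 → HasDerivAt G (g θ) θ)
    (hzero : Tendsto (fun ε => G (acotDiff x ε) - G (acotDiff x (-ε))) (𝓝[>] 0) (𝓝 0)) :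
    HasPV f (G (π - acot x) - G (-acot x)) := by
  obtain ⟨h_pos, h_lt⟩ := acot_mem_Ioo x
  have h_top : ContinuousAt G (-acot x) :=
    (hG _ ⟨by linarith, by linarith⟩ (by linarith)).continuousAt
  have h_bot : ContinuousAt G (π - acot x) :=
    (hG _ ⟨by linarith, by linarith⟩ (by linarith)).continuousAt
  rw [← neg_sub_neg]
  refine HasPV.of_hasDerivAt (F := fun y => -G (acotDiff x y)) hint (fun y hy => ?_)
    (h_bot.tendsto.comp (tendsto_acotDiff_atBot x)).neg
    (h_top.tendsto.comp (tendsto_acotDiff_atTop x)).neg ?_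
  · have h := (hG _ (acotDiff_mem_Ioo x y) (acotDiff_ne_zero x hy)).scomp y
      (hasDerivAt_acotDiff x y)
    rw [hf y hy, ← neg_neg ((1 + (x + y) ^ 2)⁻¹), neg_smul]
    exact h.neg
  · simpa only [neg_sub_neg, neg_sub, neg_zero] using hzero.neg

end InverseCotangent

section HalfAngle

variable {θ : ℝ}

theorem sin_eq_two_mul_sin_half_mul_cos_half (θ : ℝ) :
    Real.sin θ = 2 * Real.sin (θ / 2) * Real.cos (θ / 2) := by
  rw [← Real.sin_two_mul, mul_div_cancel₀ θ two_ne_zero]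

theorem one_add_cos_eq_two_mul_cos_half_sq (θ : ℝ) :
    1 + Real.cos θ = 2 * Real.cos (θ / 2) ^ 2 := by
  rw [Real.cos_sq, mul_div_cancel₀ θ two_ne_zero]
  ring

theorem sin_half_ne_zero (hθ : Real.sin θ ≠ 0) : Real.sin (θ / 2) ≠ 0 := fun h =>
  hθ (by rw [sin_eq_two_mul_sin_half_mul_cos_half, h, mul_zero, zero_mul])

theorem cos_half_ne_zero (hθ : Real.sin θ ≠ 0) : Real.cos (θ / 2) ≠ 0 := fun h =>
  hθ (by rw [sin_eq_two_mul_sin_half_mul_cos_half, h, mul_zero])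

theorem cot_half_eq (hθ : Real.sin θ ≠ 0) :
    Real.cot (θ / 2) = (1 + Real.cos θ) / Real.sin θ := by
  have h_sin := sin_half_ne_zero hθ
  have h_cos := cos_half_ne_zero hθ
  rw [sin_eq_two_mul_sin_half_mul_cos_half, one_add_cos_eq_two_mul_cos_half_sq,
    Real.cot_eq_cos_div_sin]
  field_simp

theorem cot_half_pos (hθ : θ ∈ Ioo 0 π) : 0 < Real.cot (θ / 2) := by
  rw [Real.cot_eq_cos_div_sin]
  exact div_pos (Real.cos_pos_of_mem_Ioo ⟨by linarith [hθ.1, Real.pi_pos], by linarith [hθ.2]⟩)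
    (Real.sin_pos_of_pos_of_lt_pi (by linarith [hθ.1]) (by linarith [hθ.1, hθ.2]))

theorem hasDerivAt_tan_half (hθ : Real.cos (θ / 2) ≠ 0) :
    HasDerivAt (fun θ => Real.tan (θ / 2)) (1 + Real.cos θ)⁻¹ θ := by
  refine ((Real.hasDerivAt_tan hθ).comp θ ((hasDerivAt_id θ).div_const 2)).congr_deriv ?_
  rw [one_add_cos_eq_two_mul_cos_half_sq]
  field_simp

theorem hasDerivAt_log_tan_half (hθ : Real.sin θ ≠ 0) :
    HasDerivAt (fun θ => Real.log (Real.tan (θ / 2))) (Real.sin θ)⁻¹ θ := by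
  have h_sin := sin_half_ne_zero hθ
  have h_cos := cos_half_ne_zero hθ
  have h_tan : Real.tan (θ / 2) ≠ 0 :=
    Real.tan_eq_sin_div_cos (θ / 2) ▸ div_ne_zero h_sin h_cos
  refine ((hasDerivAt_tan_half h_cos).log h_tan).congr_deriv ?_
  rw [sin_eq_two_mul_sin_half_mul_cos_half, one_add_cos_eq_two_mul_cos_half_sq,
    Real.tan_eq_sin_div_cos]
  field_simp

end HalfAngle

section PhaseIntegrand

theorem norm_exp_I_mul_intCast_mul (k : ℤ) (t : ℝ) : ‖Complex.exp (I * k * t)‖ = 1 := by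
  rw [show I * k * t = ((k * t : ℝ) : ℂ) * I by push_cast; ring, Complex.norm_exp_ofReal_mul_I]

theorem intCast_ne_zero_of_odd {k : ℤ} (hk : Odd k) : (k : ℂ) ≠ 0 := by
  intro h
  rw [Int.cast_eq_zero] at h
  simp [h] at hk

theorem exp_I_mul_pi_of_odd {k : ℤ} (hk : Odd k) : Complex.exp (I * k * π) = -1 := by
  obtain ⟨m, rfl⟩ := hk
  rw [show I * ((2 * m + 1 : ℤ) : ℂ) * π = m * (2 * π * I) + π * I by push_cast; ring,
    Complex.exp_add, Complex.exp_int_mul_two_pi_mul_I, Complex.exp_pi_mul_I, one_mul]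

/-- The principal value integrand of the half Laplacian at `x` of `y ↦ exp (i k acot y)`, divided by
the value of that function at `x`. -/
noncomputable def phaseIntegrand (k : ℤ) (x y : ℝ) : ℂ :=
  (1 - Complex.exp (I * k * acotDiff x y)) / (y : ℂ) ^ 2

theorem integrableOn_phaseIntegrand (k : ℤ) (x : ℝ) {ε : ℝ} (hε : 0 < ε) :
    IntegrableOn (phaseIntegrand k x) {y : ℝ | ε < |y|} := by
  have h_meas : Measurable (phaseIntegrand k x) := by
    have := (continuous_acotDiff x).measurable
    unfold phaseIntegrand
    fun_prop
  refine integrableOn_of_norm_le_div_sq (C := 2) h_meas.aestronglyMeasurable (fun y => ?_) hε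
  rw [phaseIntegrand, norm_div, norm_pow, Complex.norm_real, Real.norm_eq_abs, sq_abs]
  gcongr
  calc ‖1 - Complex.exp (I * k * acotDiff x y)‖
      ≤ ‖(1 : ℂ)‖ + ‖Complex.exp (I * k * acotDiff x y)‖ := norm_sub_le _ _
    _ = 2 := by rw [norm_exp_I_mul_intCast_mul, norm_one, one_add_one_eq_two]

theorem phaseIntegrand_eq_smul (k : ℤ) (x y : ℝ) :
    phaseIntegrand k x y = (1 + (x + y) ^ 2)⁻¹ • (Real.sin (acot x) ^ 2 •
      ((1 - Complex.exp (I * k * acotDiff x y)) / Complex.sin (acotDiff x y) ^ 2)) := by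
  have h_sin : Complex.sin (acotDiff x y) ^ 2 =
      ((y ^ 2 * Real.sin (acot x) ^ 2 * (1 + (x + y) ^ 2)⁻¹ : ℝ) : ℂ) := by
    rw [← sin_acotDiff_sq, Complex.ofReal_pow, Complex.ofReal_sin]
  have h_ne : (((1 + (x + y) ^ 2)⁻¹ * Real.sin (acot x) ^ 2 : ℝ) : ℂ) ≠ 0 := by
    rw [sin_acot_sq]
    exact Complex.ofReal_ne_zero.2 (by positivity)
  rw [phaseIntegrand, h_sin, smul_smul, Complex.real_smul, ← mul_div_assoc,
    show y ^ 2 * Real.sin (acot x) ^ 2 * (1 + (x + y) ^ 2)⁻¹ =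
      (1 + (x + y) ^ 2)⁻¹ * Real.sin (acot x) ^ 2 * y ^ 2 by ring,
    Complex.ofReal_mul _ (y ^ 2), mul_div_mul_left _ _ h_ne, Complex.ofReal_pow]

theorem hasPV_exp_acotDiff {k : ℤ} (hk : Odd k) (x : ℝ) :
    HasPV (fun y => (1 + (x + y) ^ 2)⁻¹ • Complex.exp (I * k * acotDiff x y))
      (2 * I / k * Complex.exp (-(I * k * acot x))) := by
  have hk' := intCast_ne_zero_of_odd hk
  have h_cont := continuous_acotDiff x
  have h_int : Integrable fun y => (1 + (x + y) ^ 2)⁻¹ • Complex.exp (I * k * acotDiff x y) := by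
    refine (integrable_inv_one_add_sq.comp_add_left x).mono'
      (Measurable.aestronglyMeasurable (by fun_prop)) (ae_of_all _ fun y => ?_)
    rw [norm_smul, norm_exp_I_mul_intCast_mul, mul_one, Real.norm_of_nonneg (by positivity)]
  have h_deriv : ∀ θ : ℝ, HasDerivAt (fun θ : ℝ => -(I / k) * Complex.exp (I * k * θ))
      (Complex.exp (I * k * θ)) θ := by
    intro θ
    refine (((hasDerivAt_id θ).ofReal_comp.const_mul (I * k)).cexp.const_mul
      (-(I / k))).congr_deriv ?_
    rw [id, Complex.ofReal_one]
    field_simp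
    linear_combination -Complex.I_sq
  have h_zero : Tendsto (fun ε : ℝ => -(I / k) * Complex.exp (I * k * acotDiff x ε) -
      -(I / k) * Complex.exp (I * k * acotDiff x (-ε))) (𝓝[>] 0) (𝓝 0) :=
    ((by fun_prop : Continuous _).tendsto' _ _ (by rw [neg_zero, sub_self])).mono_left
      nhdsWithin_le_nhds
  convert HasPV.of_primitive_comp_acotDiff (fun ε _ => h_int.integrableOn) (fun _ _ => rfl)
    (fun θ _ _ => h_deriv θ) h_zero using 1
  have h_refl : Complex.exp (I * k * ((π - acot x : ℝ) : ℂ)) =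
      -Complex.exp (-(I * k * acot x)) := by
    rw [Complex.ofReal_sub, mul_sub, sub_eq_add_neg, Complex.exp_add, exp_I_mul_pi_of_odd hk,
      neg_one_mul]
  rw [h_refl, Complex.ofReal_neg, mul_neg (I * k)]
  ring

theorem phaseIntegrand_second_difference (k : ℤ) (x : ℝ) {y : ℝ} (hy : y ≠ 0) :
    phaseIntegrand (k + 2) x y - (2 : ℝ) • phaseIntegrand k x y + phaseIntegrand (k - 2) x y =
      (4 * Real.sin (acot x) ^ 2) •
        ((1 + (x + y) ^ 2)⁻¹ • Complex.exp (I * k * acotDiff x y)) := by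
  have h_sin : Complex.sin (acotDiff x y) ^ 2 =
      (y : ℂ) ^ 2 * ((Real.sin (acot x) ^ 2 * (1 + (x + y) ^ 2)⁻¹ : ℝ) : ℂ) := by
    rw [← Complex.ofReal_sin, ← Complex.ofReal_pow, sin_acotDiff_sq, mul_assoc]
    push_cast
    rfl
  have hy' : (y : ℂ) ≠ 0 := Complex.ofReal_ne_zero.2 hy
  set θ := acotDiff x y
  have h_two_cos : Complex.exp (I * 2 * θ) + Complex.exp (-(I * 2 * θ)) =
      2 - 4 * Complex.sin θ ^ 2 := by
    have h := Complex.two_cos (2 * (θ : ℂ))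
    rw [Complex.cos_two_mul, Complex.cos_sq'] at h
    rw [show I * 2 * θ = 2 * (θ : ℂ) * I by ring, ← neg_mul, ← h]
    ring
  have h_up : Complex.exp (I * (k + 2) * θ) =
      Complex.exp (I * k * θ) * Complex.exp (I * 2 * θ) := by
    rw [← Complex.exp_add]; ring_nf
  have h_down : Complex.exp (I * (k - 2) * θ) =
      Complex.exp (I * k * θ) * Complex.exp (-(I * 2 * θ)) := by
    rw [← Complex.exp_add]; ring_nf
  simp only [phaseIntegrand, Int.cast_add, Int.cast_sub, Int.cast_ofNat,
    Complex.real_smul]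
  rw [h_up, h_down]
  rw [h_sin] at h_two_cos
  generalize Complex.exp (I * 2 * θ) = P at h_two_cos ⊢
  generalize Complex.exp (-(I * 2 * θ)) = Q at h_two_cos ⊢
  push_cast at h_two_cos ⊢
  field_simp
  linear_combination -Complex.exp (I * k * θ) * h_two_cos

theorem exp_I_mul_intCast_mul_eq {σ : ℤ} (hσ : IsUnit σ) (θ : ℝ) :
    Complex.exp (I * σ * θ) = Real.cos θ + I * σ * Real.sin θ := by
  rw [show I * σ * θ = (σ * θ) * I by ring, Complex.exp_mul_I]
  rcases Int.isUnit_iff.1 hσ with rfl | rfl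
  · simp [mul_comm]
  · simp [mul_comm]

/-- A primitive of `(1 - exp (i σ θ)) / sin θ ^ 2` for `σ = ±1`. -/
noncomputable def unitPhasePrimitive (σ : ℤ) (θ : ℝ) : ℂ :=
  Real.tan (θ / 2) - I * σ * Real.log (Real.tan (θ / 2))

theorem hasDerivAt_unitPhasePrimitive {σ : ℤ} (hσ : IsUnit σ) {θ : ℝ} (hθ : Real.sin θ ≠ 0) :
    HasDerivAt (unitPhasePrimitive σ)
      ((1 - Complex.exp (I * σ * θ)) / Complex.sin θ ^ 2) θ := by
  refine ((hasDerivAt_tan_half (cos_half_ne_zero hθ)).ofReal_comp.sub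
    ((hasDerivAt_log_tan_half hθ).ofReal_comp.const_mul (I * σ))).congr_deriv ?_
  have h_split : (1 + Real.cos θ)⁻¹ = (1 - Real.cos θ) / Real.sin θ ^ 2 := by
    have h_ne : 1 + Real.cos θ ≠ 0 := fun h => hθ <| pow_eq_zero_iff two_ne_zero |>.1 <| by
      rw [Real.sin_sq]
      linear_combination (1 - Real.cos θ) * h
    rw [inv_eq_one_div, div_eq_div_iff h_ne (pow_ne_zero 2 hθ), Real.sin_sq]
    ring
  have hθ' : Complex.sin θ ≠ 0 := by exact_mod_cast hθ
  rw [h_split, exp_I_mul_intCast_mul_eq hσ]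
  push_cast
  field_simp
  ring

theorem tendsto_unitPhasePrimitive_acotDiff_sub (σ : ℤ) (x : ℝ) :
    Tendsto (fun ε => unitPhasePrimitive σ (acotDiff x ε) - unitPhasePrimitive σ (acotDiff x (-ε)))
      (𝓝[>] 0) (𝓝 0) := by
  have h_deriv : HasDerivAt (fun y => Real.tan (acotDiff x y / 2))
      ((1 + Real.cos (acotDiff x 0))⁻¹ * -(1 + (x + 0) ^ 2)⁻¹) 0 :=
    (hasDerivAt_tan_half (by rw [acotDiff_zero, zero_div, Real.cos_zero]; exact one_ne_zero)).comp
      0 (hasDerivAt_acotDiff x 0)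
  have h_slope : (1 + Real.cos (acotDiff x 0))⁻¹ * -(1 + (x + 0) ^ 2)⁻¹ ≠ 0 := by
    rw [acotDiff_zero, Real.cos_zero, one_add_one_eq_two]
    exact mul_ne_zero (by norm_num) (neg_ne_zero.2 (by positivity))
  have h_zero : Real.tan (acotDiff x 0 / 2) = 0 := by rw [acotDiff_zero, zero_div, Real.tan_zero]
  have h_log := tendsto_log_sub_log_neg h_deriv h_zero h_slope
  have h_neg : Tendsto (fun ε : ℝ => -ε) (𝓝[>] 0) (𝓝 0) :=
    (continuous_neg.tendsto' 0 0 neg_zero).mono_left nhdsWithin_le_nhds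
  have h_tan := (h_deriv.continuousAt.tendsto.mono_left nhdsWithin_le_nhds).sub
    (h_deriv.continuousAt.tendsto.comp h_neg)
  have h := h_tan.ofReal.sub (h_log.ofReal.const_mul (I * σ))
  rw [sub_self, Complex.ofReal_zero, mul_zero, sub_zero] at h
  refine h.congr fun ε => ?_
  rw [unitPhasePrimitive, unitPhasePrimitive, Function.comp_apply]
  push_cast
  ring

theorem unitPhasePrimitive_sub (σ : ℤ) {s : ℝ} (hs : s ∈ Ioo 0 π) :
    unitPhasePrimitive σ (π - s) - unitPhasePrimitive σ (-s) =
      2 / Real.sin s - 2 * I * σ * Real.log (Real.cot (s / 2)) := by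
  have h_ne : Real.sin s ≠ 0 := (Real.sin_pos_of_mem_Ioo hs).ne'
  have h_cot : Real.tan ((π - s) / 2) = Real.cot (s / 2) := by
    rw [sub_div, Real.tan_pi_div_two_sub, Real.tan_inv_eq_cot]
  have h_tan : Real.tan (-s / 2) = -(Real.cot (s / 2))⁻¹ := by
    rw [neg_div, Real.tan_neg, ← Real.tan_inv_eq_cot, inv_inv]
  have h_sum : Real.cot (s / 2) + (Real.cot (s / 2))⁻¹ = 2 / Real.sin s := by
    have h_cot_ne : 1 + Real.cos s ≠ 0 := fun h =>
      (cot_half_pos hs).ne' (by rw [cot_half_eq h_ne, h, zero_div])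
    rw [cot_half_eq h_ne]
    field_simp
    linear_combination Real.sin_sq_add_cos_sq s
  rw [unitPhasePrimitive, unitPhasePrimitive, h_cot, h_tan, Real.log_neg_eq_log, Real.log_inv,
    ← Complex.ofReal_ofNat, ← Complex.ofReal_div, ← h_sum]
  push_cast
  ring

theorem hasPV_phaseIntegrand_of_isUnit {σ : ℤ} (hσ : IsUnit σ) (x : ℝ) :
    HasPV (phaseIntegrand σ x) (2 * Real.sin (acot x) -
      2 * I * σ * Real.sin (acot x) ^ 2 * Real.log (Real.cot (acot x / 2))) := by
  set r : ℝ := Real.sin (acot x) ^ 2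
  have h_deriv : ∀ θ ∈ Ioo (-π) π, θ ≠ 0 → HasDerivAt (fun θ => r • unitPhasePrimitive σ θ)
      (r • ((1 - Complex.exp (I * σ * θ)) / Complex.sin θ ^ 2)) θ := fun θ hθ h_ne =>
    (hasDerivAt_unitPhasePrimitive hσ fun h_sin =>
      h_ne ((Real.sin_eq_zero_iff_of_lt_of_lt hθ.1 hθ.2).1 h_sin)).fun_const_smul r
  have h_zero : Tendsto (fun ε => r • unitPhasePrimitive σ (acotDiff x ε) -
      r • unitPhasePrimitive σ (acotDiff x (-ε))) (𝓝[>] 0) (𝓝 0) := by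
    simpa only [smul_sub, smul_zero] using
      (tendsto_unitPhasePrimitive_acotDiff_sub σ x).const_smul r
  have h := HasPV.of_primitive_comp_acotDiff (fun ε hε => integrableOn_phaseIntegrand σ x hε)
    (fun y _ => phaseIntegrand_eq_smul σ x y) h_deriv h_zero
  have h_ne : (Real.sin (acot x) : ℂ) ≠ 0 :=
    Complex.ofReal_ne_zero.2 (Real.sin_pos_of_mem_Ioo (acot_mem_Ioo x)).ne'
  rw [← smul_sub, unitPhasePrimitive_sub σ (acot_mem_Ioo x), Complex.real_smul,
    Complex.ofReal_pow, mul_sub, mul_div_assoc', pow_two, mul_assoc, mul_comm _ (2 : ℂ),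
    ← mul_assoc, mul_div_cancel_right₀ _ h_ne] at h
  convert h using 1
  ring

end PhaseIntegrand

section CubicSeries

/-- The coefficient `1 / ((j - 2) j (j + 2))`, which is `0` for `j = 0, 2, -2`. -/
noncomputable def cubicWeight (j : ℤ) : ℂ := (((j : ℂ) - 2) * j * (j + 2))⁻¹

theorem norm_cubicWeight_le (j : ℤ) : ‖cubicWeight j‖ ≤ 1 / (j : ℝ) ^ 2 := by
  have h_cast : cubicWeight j = (((j - 2) * j * (j + 2) : ℤ) : ℂ)⁻¹ := by
    rw [cubicWeight]
    push_cast
    rfl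
  rw [h_cast, norm_inv, Complex.norm_intCast, ← one_div]
  by_cases h : (j - 2) * j * (j + 2) = 0
  · rw [h, Int.cast_zero, abs_zero, div_zero]
    positivity
  obtain ⟨⟨h_sub, h_zero⟩, h_add⟩ : (j - 2 ≠ 0 ∧ j ≠ 0) ∧ j + 2 ≠ 0 := by
    simpa only [mul_ne_zero_iff] using h
  have h_abs : |j| ≤ |j ^ 2 - 4| := by
    have h_pos : 0 < |j| := abs_pos.2 h_zero
    have h_two : |j| ≠ 2 := fun h => (abs_eq zero_le_two).1 h |>.elim (by lia) (by lia)
    rw [← sq_abs j, le_abs]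
    obtain h_one | h_three : |j| = 1 ∨ 3 ≤ |j| := by lia
    · exact Or.inr (by rw [h_one]; norm_num)
    · exact Or.inl (by nlinarith)
  have h_sq : j ^ 2 ≤ |(j - 2) * j * (j + 2)| := by
    calc j ^ 2 = |j| * |j| := by rw [← sq, sq_abs]
      _ ≤ |j ^ 2 - 4| * |j| := by gcongr
      _ = |(j - 2) * j * (j + 2)| := by rw [← abs_mul]; ring_nf
  exact one_div_le_one_div_of_le (by positivity) (by exact_mod_cast h_sq)

theorem summable_norm_cubicWeight : Summable fun j => ‖cubicWeight j‖ :=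
  (Real.summable_one_div_int_pow.2 one_lt_two).of_nonneg_of_le (fun _ => norm_nonneg _)
    norm_cubicWeight_le

theorem cubicWeight_odd_eq (n : ℕ) : cubicWeight (2 * n + 1) =
    (1 / (2 * n + 1 - 2) - 2 / (2 * n + 1) + 1 / (2 * n + 1 + 2)) / 8 := by
  have h_odd : Odd (2 * (n : ℤ) + 1) := ⟨n, rfl⟩
  have h_zero := intCast_ne_zero_of_odd h_odd
  have h_add := intCast_ne_zero_of_odd (h_odd.add_even even_two)
  have h_sub := intCast_ne_zero_of_odd (h_odd.sub_even even_two)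
  rw [cubicWeight]
  push_cast at h_zero h_add h_sub ⊢
  field_simp
  ring

variable {z : ℂ}

theorem hasSum_odd_pow_div (hz : ‖z‖ < 1) :
    HasSum (fun n : ℕ => z ^ (2 * n + 1) / (2 * n + 1)) (Complex.log ((1 + z) / (1 - z)) / 2) := by
  have h := (Complex.hasSum_arctan (z := -I * z) (by simpa using hz)).mul_left I
  rw [Complex.arctan, show -I * z * I = z by linear_combination -z * Complex.I_sq, ← mul_assoc,
    show I * (-I / 2) = 1 / 2 by linear_combination -Complex.I_sq / 2, one_div_mul_eq_div] at h
  refine h.congr_fun fun n => ?_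
  have h_pow : (-I) ^ (2 * n + 1) = (-1) ^ n * -I := by
    rw [pow_succ, pow_mul, neg_sq, Complex.I_sq]
  have h_one : (-1 : ℂ) ^ n * (-1) ^ n = 1 := by rw [← mul_pow, neg_one_mul, neg_neg, one_pow]
  rw [mul_pow, h_pow]
  push_cast
  linear_combination (z ^ (2 * n + 1) / (2 * n + 1)) *
    (-h_one + (-1 : ℂ) ^ n * (-1) ^ n * Complex.I_sq)

theorem hasSum_cubicWeight (hz : ‖z‖ < 1) :
    HasSum (fun n : ℕ => 8 * z ^ 2 * (z ^ (2 * n + 1) * cubicWeight (2 * n + 1)))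
      ((z ^ 2 - 1) ^ 2 * (Complex.log ((1 + z) / (1 - z)) / 2) - z * (z ^ 2 + 1)) := by
  have h_mid := hasSum_odd_pow_div hz
  set A := Complex.log ((1 + z) / (1 - z)) / 2
  have h_low : HasSum (fun n : ℕ => z ^ (2 * n + 1) / (2 * n + 1 - 2)) (z ^ 2 * A - z) := by
    refine (hasSum_nat_add_iff' 1).1 ?_
    have h_first : ∑ n ∈ Finset.range 1, z ^ (2 * n + 1) / (2 * (n : ℂ) + 1 - 2) = -z := by
      norm_num [div_neg]
    rw [h_first, sub_sub, add_neg_cancel, sub_zero]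
    refine (h_mid.mul_left (z ^ 2)).congr_fun fun n => ?_
    push_cast
    rw [show 2 * ((n : ℂ) + 1) + 1 - 2 = 2 * n + 1 by ring]
    ring
  have h_high : HasSum (fun n : ℕ => z ^ 2 * (z ^ (2 * n + 1) / (2 * n + 1 + 2))) (A - z) := by
    have h_first : ∑ n ∈ Finset.range 1, z ^ (2 * n + 1) / (2 * (n : ℂ) + 1) = z := by
      norm_num
    have h_tail := (hasSum_nat_add_iff' 1).2 h_mid
    rw [h_first] at h_tail
    refine h_tail.congr_fun fun n => ?_
    push_cast
    rw [show 2 * ((n : ℂ) + 1) + 1 = 2 * n + 1 + 2 by ring]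
    ring
  have h_total := ((h_low.mul_left (z ^ 2)).sub (h_mid.mul_left (2 * z ^ 2))).add h_high
  rw [show z ^ 2 * (z ^ 2 * A - z) - 2 * z ^ 2 * A + (A - z) =
    (z ^ 2 - 1) ^ 2 * A - z * (z ^ 2 + 1) by ring] at h_total
  refine h_total.congr_fun fun n => ?_
  rw [cubicWeight_odd_eq]
  ring

-- Both sides are continuous up to the boundary circle away from `±1`.
theorem tsum_cubicWeight (hz : ‖z‖ ≤ 1) (h_slit : (1 + z) / (1 - z) ∈ Complex.slitPlane) :
    8 * z ^ 2 * ∑' n : ℕ, z ^ (2 * n + 1) * cubicWeight (2 * n + 1) =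
      (z ^ 2 - 1) ^ 2 * (Complex.log ((1 + z) / (1 - z)) / 2) - z * (z ^ 2 + 1) := by
  have h_ne : 1 - z ≠ 0 := fun h => Complex.slitPlane_ne_zero h_slit (by rw [h, div_zero])
  have h_sub : Metric.ball (0 : ℂ) 1 ⊆ Metric.closedBall 0 1 := Metric.ball_subset_closedBall
  have h_cont : ContinuousOn (fun z : ℂ => ∑' n : ℕ, z ^ (2 * n + 1) * cubicWeight (2 * n + 1))
      (Metric.closedBall 0 1) := by
    refine continuousOn_tsum (fun n => by fun_prop) (summable_norm_cubicWeight.comp_injective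
      (i := fun n : ℕ => 2 * (n : ℤ) + 1) fun m n h => by simpa using h) fun n w hw => ?_
    rw [norm_mul, norm_pow]
    exact mul_le_of_le_one_left (norm_nonneg _)
      (pow_le_one₀ (norm_nonneg _) (mem_closedBall_zero_iff.1 hw))
  have h_left : Tendsto (fun z : ℂ => 8 * z ^ 2 * ∑' n : ℕ, z ^ (2 * n + 1) *
      cubicWeight (2 * n + 1)) (𝓝[Metric.ball 0 1] z) _ :=
    ((by fun_prop : Continuous fun z : ℂ => 8 * z ^ 2).continuousWithinAt).mul
      ((h_cont z (mem_closedBall_zero_iff.2 hz)).mono h_sub)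
  have h_right : ContinuousAt (fun z : ℂ => (z ^ 2 - 1) ^ 2 *
      (Complex.log ((1 + z) / (1 - z)) / 2) - z * (z ^ 2 + 1)) z := by
    have h_div : ContinuousAt (fun z : ℂ => (1 + z) / (1 - z)) z := by
      fun_prop (disch := exact h_ne)
    have h_log := h_div.clog h_slit
    fun_prop
  have : (𝓝[Metric.ball (0 : ℂ) 1] z).NeBot := by
    rw [← mem_closure_iff_nhdsWithin_neBot, closure_ball 0 one_ne_zero]
    exact mem_closedBall_zero_iff.2 hz
  refine tendsto_nhds_unique h_left ((h_right.tendsto.mono_left nhdsWithin_le_nhds).congr' ?_)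
  filter_upwards [self_mem_nhdsWithin] with w hw
  rw [← tsum_mul_left, (hasSum_cubicWeight (mem_ball_zero_iff.1 hw)).tsum_eq]

/-- The Fourier-type summand `e ^ (i j s) / ((j - 2) j (j + 2))`. -/
noncomputable def phaseTerm (s : ℝ) (j : ℤ) : ℂ := Complex.exp (I * j * s) * cubicWeight j

/-- The sum of `phaseTerm s j` over `j = -k, -k + 2, -k + 4, …`. -/
noncomputable def phaseSum (s : ℝ) (k : ℤ) : ℂ := ∑' n : ℕ, phaseTerm s (2 * n - k)

theorem summable_phaseTerm (s : ℝ) (k : ℤ) : Summable fun n : ℕ => phaseTerm s (2 * n - k) := by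
  refine .of_norm_bounded (summable_norm_cubicWeight.comp_injective
    (i := fun n : ℕ => 2 * (n : ℤ) - k) fun m n h => by simpa using h) fun n => ?_
  rw [phaseTerm, norm_mul, norm_exp_I_mul_intCast_mul, one_mul, Function.comp_apply]

theorem phaseSum_eq_sum_add (s : ℝ) (k : ℤ) (m : ℕ) :
    phaseSum s k = ∑ n ∈ Finset.range m, phaseTerm s (2 * n - k) + phaseSum s (k - 2 * m) := by
  rw [phaseSum, ← (summable_phaseTerm s k).sum_add_tsum_nat_add m, phaseSum]
  congr 1
  refine tsum_congr fun n => ?_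
  congr 1
  push_cast
  ring

theorem phaseSum_eq_add_sub_two (s : ℝ) (k : ℤ) :
    phaseSum s k = phaseTerm s (-k) + phaseSum s (k - 2) := by
  simpa using phaseSum_eq_sum_add s k 1

theorem one_add_exp_div_one_sub_exp (s : ℝ) :
    (1 + Complex.exp (I * s)) / (1 - Complex.exp (I * s)) = Real.cot (s / 2) * I := by
  have h := Complex.cot_eq_exp_ratio (s / 2)
  rw [show 2 * I * ((s : ℂ) / 2) = I * s by ring] at h
  rw [Complex.ofReal_cot, Complex.ofReal_div, Complex.ofReal_ofNat, h, div_mul_eq_mul_div,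
    mul_comm _ I, mul_div_mul_left _ _ Complex.I_ne_zero, add_comm]

/-- The bracket `cos s + sin² s log (cot (s / 2))` of the closed form. -/
noncomputable def logBracket (s : ℝ) : ℝ :=
  Real.cos s + Real.sin s ^ 2 * Real.log (Real.cot (s / 2))

theorem phaseSum_neg_one {s : ℝ} (hs : s ∈ Ioo 0 π) :
    phaseSum s (-1) = -(logBracket s + I * π / 2 * Real.sin s ^ 2) / 4 := by
  set w := Complex.exp (I * s) with hw
  have h_ratio := one_add_exp_div_one_sub_exp s
  rw [← hw] at h_ratio
  have h_log : Complex.log ((1 + w) / (1 - w)) = Real.log (Real.cot (s / 2)) + I * π / 2 := by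
    rw [h_ratio, Complex.log_ofReal_mul (cot_half_pos hs) Complex.I_ne_zero, Complex.log_I]
    ring
  have h_slit : (1 + w) / (1 - w) ∈ Complex.slitPlane := by
    rw [h_ratio, Complex.mem_slitPlane_iff, Complex.im_ofReal_mul, Complex.I_im, mul_one]
    exact Or.inr (cot_half_pos hs).ne'
  have h_norm : ‖w‖ ≤ 1 := by rw [hw, mul_comm, Complex.norm_exp_ofReal_mul_I]
  have h_term (n : ℕ) : phaseTerm s (2 * n - -1) = w ^ (2 * n + 1) * cubicWeight (2 * n + 1) := by
    rw [phaseTerm, hw, ← Complex.exp_nat_mul, sub_neg_eq_add]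
    push_cast
    ring_nf
  have h_sum := tsum_cubicWeight h_norm h_slit
  simp only [← h_term] at h_sum
  rw [← phaseSum, h_log] at h_sum
  have h_euler : w = Real.cos s + I * Real.sin s := by
    rw [hw, mul_comm, Complex.exp_mul_I]
    push_cast
    ring
  have h_sq : (Real.sin s : ℂ) ^ 2 + (Real.cos s : ℂ) ^ 2 = 1 := by
    exact_mod_cast Real.sin_sq_add_cos_sq s
  have h_sub : w ^ 2 - 1 = 2 * I * Real.sin s * w := by
    rw [h_euler]
    linear_combination h_sq - (Real.sin s : ℂ) ^ 2 * Complex.I_sq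
  have h_add : w ^ 2 + 1 = 2 * Real.cos s * w := by
    rw [h_euler]
    linear_combination -h_sq + (Real.sin s : ℂ) ^ 2 * Complex.I_sq
  have h_ne : 8 * w ^ 2 ≠ 0 := mul_ne_zero (by norm_num) (pow_ne_zero 2 (Complex.exp_ne_zero _))
  refine mul_left_cancel₀ h_ne (h_sum.trans ?_)
  rw [h_sub, h_add, logBracket, Complex.ofReal_add, Complex.ofReal_mul, Complex.ofReal_pow]
  linear_combination (2 * Real.sin s ^ 2 * w ^ 2 * (Real.log (Real.cot (s / 2)) + I * π / 2)) *
    Complex.I_sq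

end CubicSeries

section Hypergeometric

theorem ascPochhammer_eval_add_three {R : Type*} [CommRing R] (b : R) (n : ℕ) :
    (ascPochhammer R n).eval (b + 3) * (b * (b + 1) * (b + 2)) =
      (ascPochhammer R n).eval b * ((b + n) * (b + n + 1) * (b + n + 2)) := by
  induction n with
  | zero => simp
  | succ n ih =>
    rw [ascPochhammer_succ_eval, ascPochhammer_succ_eval]
    push_cast
    linear_combination (b + 3 + n) * ih

theorem ascPochhammer_eval_neg_half_add_two_ne_zero {k : ℤ} (hk : Odd k) (n : ℕ) :
    (ascPochhammer ℂ n).eval (-(k : ℂ) / 2 + 2) ≠ 0 := by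
  intro h
  obtain ⟨m, -, hm⟩ := (ascPochhammer_eval_eq_zero_iff _ _).1 h
  have h_eq : (k : ℂ) = ((2 * (m + 2) : ℤ) : ℂ) := by
    push_cast
    linear_combination (-2) * hm
  rw [Int.cast_inj.1 h_eq] at hk
  exact Int.not_odd_iff_even.2 (even_two_mul _) hk

theorem hypTerm_eq_phaseTerm {k : ℤ} (hk : Odd k) (s : ℝ) (n : ℕ) :
    hypTerm k (Complex.exp (2 * I * s)) n =
      k * (4 - (k : ℂ) ^ 2) * Complex.exp (I * k * s) * phaseTerm s (2 * n - k) := by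
  have h_odd : Odd (2 * (n : ℤ) - k) := (even_two_mul _).sub_odd hk
  have h_zero := intCast_ne_zero_of_odd h_odd
  have h_add := intCast_ne_zero_of_odd (h_odd.add_even even_two)
  have h_sub := intCast_ne_zero_of_odd (h_odd.sub_even even_two)
  have h_ne := ascPochhammer_eval_neg_half_add_two_ne_zero hk n
  have h_shift := ascPochhammer_eval_add_three (-(k : ℂ) / 2 - 1) n
  rw [show -(k : ℂ) / 2 - 1 + 3 = -(k : ℂ) / 2 + 2 by ring] at h_shift
  have h_exp : Complex.exp (2 * I * s) ^ n =
      Complex.exp (I * k * s) * Complex.exp (I * (2 * n - k : ℤ) * s) := by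
    rw [← Complex.exp_nat_mul, ← Complex.exp_add]
    push_cast
    ring_nf
  have h_factorial : (n.factorial : ℂ) ≠ 0 := Nat.cast_ne_zero.2 n.factorial_ne_zero
  rw [hypTerm, ordinaryHypergeometricSeries_apply_eq, h_exp, ascPochhammer_eval_one, phaseTerm,
    cubicWeight, smul_eq_mul]
  push_cast at h_zero h_add h_sub h_shift ⊢
  generalize (ascPochhammer ℂ n).eval (-(k : ℂ) / 2 + 2) = P at *
  generalize (ascPochhammer ℂ n).eval (-(k : ℂ) / 2 - 1) = Q at *
  field_simp
  linear_combination (-8) * h_shift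

theorem summable_hypTerm {k : ℤ} (hk : Odd k) (s : ℝ) :
    Summable (hypTerm k (Complex.exp (2 * I * s))) :=
  ((summable_phaseTerm s k).mul_left _).congr fun n => (hypTerm_eq_phaseTerm hk s n).symm

theorem ordinaryHypergeometric_eq_phaseSum {k : ℤ} (hk : Odd k) (s : ℝ) :
    ordinaryHypergeometric (1 : ℂ) (-(k : ℂ) / 2 - 1) (-(k : ℂ) / 2 + 2)
      (Complex.exp (2 * I * s)) =
      k * (4 - (k : ℂ) ^ 2) * Complex.exp (I * k * s) * phaseSum s k := by
  rw [ordinaryHypergeometric, FormalMultilinearSeries.sum, phaseSum, ← tsum_mul_left]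
  exact tsum_congr fun n => hypTerm_eq_phaseTerm hk s n

end Hypergeometric

section PhaseValue

/-- The principal value of `phaseIntegrand k x` for odd `k`, as a function of `s = acot x`. -/
noncomputable def phaseValue (s : ℝ) (k : ℤ) : ℂ :=
  -(2 * I / (k + 2)) * Complex.exp (-(I * k * s)) - k * π * Real.sin s ^ 2 +
    8 * I * k * phaseSum s k

theorem phaseTerm_neg (s : ℝ) (k : ℤ) : phaseTerm s (-k) =
    -(Complex.exp (-(I * k * s)) / (((k : ℂ) - 2) * k * (k + 2))) := by
  rw [phaseTerm, cubicWeight, ← div_neg, ← div_eq_mul_inv]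
  push_cast
  ring_nf

theorem phaseValue_eq_sub_two (s : ℝ) {k : ℤ} (hk : Odd k) :
    phaseValue s k = -(2 * I / (k - 2)) * Complex.exp (-(I * k * s)) - k * π * Real.sin s ^ 2 +
      8 * I * k * phaseSum s (k - 2) := by
  have h_zero := intCast_ne_zero_of_odd hk
  have h_add := intCast_ne_zero_of_odd (hk.add_even even_two)
  have h_sub := intCast_ne_zero_of_odd (hk.sub_even even_two)
  rw [phaseValue, phaseSum_eq_add_sub_two, phaseTerm_neg]
  push_cast at h_add h_sub
  field_simp
  ring

theorem phaseValue_second_difference (s : ℝ) {k : ℤ} (hk : Odd k) :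
    phaseValue s (k + 2) - (2 : ℝ) • phaseValue s k + phaseValue s (k - 2) =
      (4 * Real.sin s ^ 2) • (2 * I / k * Complex.exp (-(I * k * s))) := by
  have h_zero := intCast_ne_zero_of_odd hk
  have h_add := intCast_ne_zero_of_odd (hk.add_even even_two)
  have h_sub := intCast_ne_zero_of_odd (hk.sub_even even_two)
  have h_up : Complex.exp (-(I * ((k + 2 : ℤ) : ℂ) * s)) =
      Complex.exp (-(I * k * s)) * Complex.exp (-(2 * s) * I) := by
    rw [← Complex.exp_add]; push_cast; ring_nf
  have h_down : Complex.exp (-(I * ((k - 2 : ℤ) : ℂ) * s)) =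
      Complex.exp (-(I * k * s)) * Complex.exp (2 * s * I) := by
    rw [← Complex.exp_add]; push_cast; ring_nf
  have h_two_cos : Complex.exp (2 * s * I) + Complex.exp (-(2 * s) * I) =
      2 - 4 * (Real.sin s : ℂ) ^ 2 := by
    rw [← Complex.two_cos, Complex.cos_two_mul, Complex.cos_sq', Complex.ofReal_sin]
    ring
  rw [phaseValue_eq_sub_two s (hk.add_even even_two), add_sub_cancel_right, phaseValue, phaseValue,
    phaseSum_eq_add_sub_two s k, phaseTerm_neg, h_up, h_down, Complex.real_smul, Complex.real_smul]
  generalize Complex.exp (-(I * k * s)) = E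
  generalize Complex.exp (2 * s * I) = p at *
  generalize Complex.exp (-(2 * s) * I) = q at *
  push_cast [-Complex.ofReal_sin] at h_add h_sub ⊢
  rw [sub_add_cancel, add_sub_cancel_right]
  field_simp
  linear_combination -2 * I * E * (k - 2) * (k + 2) * h_two_cos

theorem phaseValue_of_isUnit {σ : ℤ} (hσ : IsUnit σ) {s : ℝ} (hs : s ∈ Ioo 0 π) :
    phaseValue s σ =
      2 * Real.sin s - 2 * I * σ * Real.sin s ^ 2 * Real.log (Real.cot (s / 2)) := by
  rcases Int.isUnit_iff.1 hσ with rfl | rfl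
  · rw [phaseValue_eq_sub_two s odd_one, show (1 : ℤ) - 2 = -1 by norm_num, phaseSum_neg_one hs,
      logBracket, ← mul_neg, ← Complex.ofReal_neg, exp_I_mul_intCast_mul_eq isUnit_one,
      Real.cos_neg, Real.sin_neg]
    push_cast [-Complex.ofReal_sin, -Complex.ofReal_cos]
    linear_combination (-2 * Real.sin s - Real.sin s ^ 2 * π : ℂ) * Complex.I_sq
  · rw [phaseValue, phaseSum_neg_one hs, logBracket, ← mul_neg, ← Complex.ofReal_neg,
      exp_I_mul_intCast_mul_eq isUnit_one.neg, Real.cos_neg, Real.sin_neg]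
    push_cast [-Complex.ofReal_sin, -Complex.ofReal_cos]
    linear_combination (-2 * Real.sin s + Real.sin s ^ 2 * π : ℂ) * Complex.I_sq

theorem odd_int_induction {P : ℤ → Prop} (h_neg_one : P (-1)) (h_one : P 1)
    (h_up : ∀ k, Odd k → P (k - 2) → P k → P (k + 2))
    (h_down : ∀ k, Odd k → P (k + 2) → P k → P (k - 2)) {k : ℤ} (hk : Odd k) : P k := by
  have h_pair (m : ℤ) : P (2 * m - 1) ∧ P (2 * m + 1) := by
    have h_odd (m : ℤ) : Odd (2 * m + 1) := ⟨m, rfl⟩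
    induction m with
    | zero => exact ⟨h_neg_one, h_one⟩
    | succ m ih =>
      have h := h_up _ (h_odd m) (by convert ih.1 using 1; ring) ih.2
      exact ⟨by convert ih.2 using 1; ring, by convert h using 1; ring⟩
    | pred m ih =>
      have h := h_down _ (h_odd (-m - 1)) (by convert ih.2 using 1; ring)
        (by convert ih.1 using 1; ring)
      exact ⟨by convert h using 1; ring, by convert ih.1 using 1; ring⟩
  obtain ⟨m, rfl⟩ := hk
  exact (h_pair m).2

theorem hasPV_phaseIntegrand {k : ℤ} (hk : Odd k) (x : ℝ) :
    HasPV (phaseIntegrand k x) (phaseValue (acot x) k) := by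
  have h_unit {σ : ℤ} (hσ : IsUnit σ) : HasPV (phaseIntegrand σ x) (phaseValue (acot x) σ) := by
    rw [phaseValue_of_isUnit hσ (acot_mem_Ioo x)]
    exact hasPV_phaseIntegrand_of_isUnit hσ x
  have h_diff {k : ℤ} (hk : Odd k) := (hasPV_exp_acotDiff hk x).const_smul
    (4 * Real.sin (acot x) ^ 2)
  refine odd_int_induction (P := fun k => HasPV (phaseIntegrand k x) (phaseValue (acot x) k))
    (h_unit isUnit_one.neg) (h_unit isUnit_one) (fun k hk h_sub h => ?_)
    (fun k hk h_add h => ?_) hk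
  · exact h.of_second_difference h_sub (h_diff hk)
      (fun y hy => phaseIntegrand_second_difference k x hy) (phaseValue_second_difference _ hk)
  · refine h.of_second_difference h_add (h_diff hk) (fun y hy => ?_) ?_
    · rw [sub_add_comm]
      exact phaseIntegrand_second_difference k x hy
    · rw [sub_add_comm]
      exact phaseValue_second_difference _ hk

theorem phaseValue_eq_closed_form_of_pos {s : ℝ} (hs : s ∈ Ioo 0 π) (m : ℕ) :
    phaseValue s (2 * m + 1) =
      -(2 * I / (2 * m + 1 + 2)) * Complex.exp (-(I * (2 * m + 1) * s)) -
      2 * I * (2 * m + 1) * (logBracket s + ∑ n ∈ Finset.range (m + 1),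
        4 * Complex.exp (-(I * (2 * n + 1) * s)) / ((2 * n - 1) * (2 * n + 1) * (2 * n + 3))) := by
  have h_sum : ∑ n ∈ Finset.range (m + 1), phaseTerm s (2 * n - (2 * m + 1)) =
      -(∑ n ∈ Finset.range (m + 1), 4 * Complex.exp (-(I * (2 * n + 1) * s)) /
        ((2 * n - 1) * (2 * n + 1) * (2 * n + 3))) / 4 := by
    rw [← Finset.sum_range_reflect, neg_div, Finset.sum_div, ← Finset.sum_neg_distrib]
    refine Finset.sum_congr rfl fun n hn => ?_
    have h_cast : ((m + 1 - 1 - n : ℕ) : ℤ) = m - n := by grind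
    rw [h_cast, show 2 * ((m : ℤ) - n) - (2 * m + 1) = -(2 * n + 1) by ring, phaseTerm_neg]
    push_cast
    ring_nf
  rw [phaseValue, phaseSum_eq_sum_add s _ (m + 1), h_sum,
    show (2 * m + 1 : ℤ) - 2 * (m + 1 : ℕ) = -1 by push_cast; ring, phaseSum_neg_one hs]
  push_cast [-Complex.ofReal_sin]
  linear_combination (-(2 * m + 1 : ℂ) * π * Real.sin s ^ 2) * Complex.I_sq

theorem phaseValue_eq_closed_form_of_neg {s : ℝ} (hs : s ∈ Ioo 0 π) (m : ℕ) :
    phaseValue s (-(2 * m + 1)) =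
      2 * I / (2 * m + 1 + 2) * Complex.exp (I * (2 * m + 1) * s) +
      2 * I * (2 * m + 1) * (logBracket s + ∑ n ∈ Finset.range (m + 1),
        4 * Complex.exp (I * (2 * n + 1) * s) / ((2 * n - 1) * (2 * n + 1) * (2 * n + 3))) := by
  have h_odd : Odd (-(2 * m + 1) : ℤ) := Odd.neg ⟨m, rfl⟩
  have h_sum : ∑ n ∈ Finset.range (m + 1), phaseTerm s (2 * n - -1) =
      (∑ n ∈ Finset.range (m + 1), 4 * Complex.exp (I * (2 * n + 1) * s) /
        ((2 * n - 1) * (2 * n + 1) * (2 * n + 3))) / 4 := by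
    rw [Finset.sum_div]
    refine Finset.sum_congr rfl fun n _ => ?_
    rw [phaseTerm, cubicWeight]
    push_cast
    ring_nf
  have h_split := phaseSum_eq_sum_add s (-1) (m + 1)
  rw [h_sum, phaseSum_neg_one hs] at h_split
  rw [phaseValue_eq_sub_two s h_odd,
    show -(2 * m + 1 : ℤ) - 2 = -1 - 2 * (m + 1 : ℕ) by push_cast; ring,
    ← sub_eq_of_eq_add' h_split]
  have h_exp : -(I * ((-(2 * m + 1) : ℤ) : ℂ) * s) = I * (2 * m + 1) * s := by push_cast; ring
  have h_div : 2 * I / (((-(2 * m + 1) : ℤ) : ℂ) - 2) = -(2 * I / (2 * m + 1 + 2)) := by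
    rw [← div_neg]; push_cast; ring_nf
  rw [h_exp, h_div]
  push_cast [-Complex.ofReal_sin]
  linear_combination ((2 * m + 1 : ℂ) * π * Real.sin s ^ 2) * Complex.I_sq

theorem phaseValue_eq_closed_form {s : ℝ} (hs : s ∈ Ioo 0 π) {k : ℤ} (hk : Odd k) :
    phaseValue s k =
      -(2 * I * k.sign / ((|k| : ℤ) + 2)) * Complex.exp (-(I * k * s)) -
      2 * I * k * (logBracket s + ∑ n ∈ Finset.range ((k.natAbs - 1) / 2 + 1),
        4 * Complex.exp (-(I * k.sign * (2 * n + 1) * s)) /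
          ((2 * n - 1) * (2 * n + 1) * (2 * n + 3))) := by
  obtain ⟨m, rfl | rfl⟩ : ∃ m : ℕ, k = 2 * m + 1 ∨ k = -(2 * m + 1) := by
    obtain ⟨m, hm⟩ := Int.natAbs_odd.2 hk
    exact ⟨m, by lia⟩
  · rw [phaseValue_eq_closed_form_of_pos hs, Int.sign_eq_one_of_pos (by lia),
      abs_of_pos (by lia), show ((2 * m + 1 : ℤ).natAbs - 1) / 2 = m by lia]
    push_cast
    simp only [mul_one]
  · rw [phaseValue_eq_closed_form_of_neg hs, Int.sign_eq_neg_one_of_neg (by lia), abs_neg,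
      abs_of_pos (by lia), show ((-(2 * m + 1) : ℤ).natAbs - 1) / 2 = m by lia]
    push_cast
    simp only [mul_neg, neg_mul, mul_one, neg_neg, neg_div, sub_neg_eq_add]

end PhaseValue

section ExpAcot

open Complex (exp)

variable {k : ℤ} {L s x : ℝ}

theorem hasHalfLaplacianAt_exp_acot (hk : Odd k) (hL : 0 < L) (hs : s = acot (x / L)) :
    HasHalfLaplacianAt (fun y => exp (I * k * acot (y / L))) x
      (exp (I * k * s) * phaseValue s k / (L * π)) := by
  have hpi : (π : ℂ) ≠ 0 := Complex.ofReal_ne_zero.2 Real.pi_ne_zero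
  have h_unit_scale : HasHalfLaplacianAt (fun y => exp (I * k * acot y)) (x / L)
      (exp (I * k * s) * phaseValue s k / π) := by
    rw [hasHalfLaplacianAt_iff_hasPV, mul_div_cancel₀ _ hpi, hs]
    refine ((hasPV_phaseIntegrand hk (x / L)).const_smul
      (exp (I * k * acot (x / L)))).congr fun y _ => ?_
    have h_exp : exp (I * k * acot (x / L + y)) =
        exp (I * k * acot (x / L)) * exp (I * k * acotDiff (x / L) y) := by
      rw [← Complex.exp_add, acotDiff]
      push_cast
      ring_nf
    rw [Pi.smul_apply, phaseIntegrand, smul_eq_mul, h_exp]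
    ring
  convert h_unit_scale.comp_div hL using 1
  rw [div_div, mul_comm (L : ℂ)]

theorem hasHalfLaplacianAt_exp_acot_series (hk : Odd k) (hL : 0 < L) (hs : s = acot (x / L)) :
    HasHalfLaplacianAt (fun y => exp (I * k * acot (y / L))) x
      (-(2 * I / (L * π * (k + 2))) - k / L * Complex.sin s ^ 2 * exp (I * k * s)
        + 8 * I * ordinaryHypergeometric (1 : ℂ) (-(k : ℂ) / 2 - 1) (-(k : ℂ) / 2 + 2)
            (exp (2 * I * s)) / (L * π * (4 - (k : ℂ) ^ 2))) := by
  have hL' : (L : ℂ) ≠ 0 := Complex.ofReal_ne_zero.2 hL.ne'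
  have hpi : (π : ℂ) ≠ 0 := Complex.ofReal_ne_zero.2 Real.pi_ne_zero
  have h_add := intCast_ne_zero_of_odd (hk.add_even even_two)
  have h_sub := intCast_ne_zero_of_odd (hk.sub_even even_two)
  push_cast at h_add h_sub
  have h_prod : 4 - (k : ℂ) ^ 2 ≠ 0 := by
    rw [show 4 - (k : ℂ) ^ 2 = -((k + 2) * (k - 2)) by ring]
    exact neg_ne_zero.2 (mul_ne_zero h_add h_sub)
  convert hasHalfLaplacianAt_exp_acot hk hL hs using 1
  rw [ordinaryHypergeometric_eq_phaseSum hk, phaseValue, Complex.exp_neg, Complex.ofReal_sin]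
  have h_exp := Complex.exp_ne_zero (I * k * s)
  field_simp

theorem hasHalfLaplacianAt_exp_acot_closed_form (hk : Odd k) (hL : 0 < L)
    (hs : s = acot (x / L)) :
    HasHalfLaplacianAt (fun y => exp (I * k * acot (y / L))) x
      (-(2 * I * k.sign / (L * π * ((|k| : ℤ) + 2))) - 2 * I * k / (L * π) * exp (I * k * s) *
        (logBracket s + ∑ n ∈ Finset.range ((k.natAbs - 1) / 2 + 1),
          4 * exp (-(I * k.sign * (2 * n + 1) * s)) /
            ((2 * n - 1) * (2 * n + 1) * (2 * n + 3)))) := by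
  convert hasHalfLaplacianAt_exp_acot hk hL hs using 1
  have h_cancel := mul_inv_cancel₀ (Complex.exp_ne_zero (I * k * s))
  rw [phaseValue_eq_closed_form (hs ▸ acot_mem_Ioo _) hk, Complex.exp_neg (I * k * s),
    ← div_div _ (L * π : ℂ)]
  linear_combination (2 * I * k.sign / (L * π) / ((|k| : ℤ) + 2)) * h_cancel

end ExpAcot

section RationalForm

theorem add_I_eq_sqrt_mul_exp (x : ℝ) :
    (x : ℂ) + I = √(x ^ 2 + 1) * Complex.exp (I * acot x) := by
  have h : (√(1 + x ^ 2) : ℂ) ≠ 0 := by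
    have : √(1 + x ^ 2) ≠ 0 := by positivity
    exact_mod_cast this
  rw [mul_comm I, Complex.exp_mul_I, ← Complex.ofReal_cos, ← Complex.ofReal_sin, sin_acot,
    cos_acot, add_comm (x ^ 2)]
  push_cast
  field_simp

theorem add_I_zpow_div_rpow (x : ℝ) (j : ℤ) :
    ((x : ℂ) + I) ^ j / (((x ^ 2 + 1) ^ ((j : ℝ) / 2) : ℝ) : ℂ) =
      Complex.exp (I * j * acot x) := by
  have h_pos : 0 < x ^ 2 + 1 := by positivity
  have h_sqrt : (√(x ^ 2 + 1) : ℂ) ≠ 0 := Complex.ofReal_ne_zero.2 (Real.sqrt_pos.2 h_pos).ne'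
  have h_rpow : (x ^ 2 + 1) ^ ((j : ℝ) / 2) = √(x ^ 2 + 1) ^ j := by
    rw [Real.sqrt_eq_rpow, ← Real.rpow_intCast, ← Real.rpow_mul h_pos.le, one_div_mul_eq_div]
  rw [add_I_eq_sqrt_mul_exp, mul_zpow, h_rpow, Complex.ofReal_zpow,
    mul_div_cancel_left₀ _ (zpow_ne_zero _ h_sqrt), ← Complex.exp_int_mul]
  ring_nf

theorem add_I_zpow_div_rpow_add_one (x : ℝ) (j : ℤ) :
    ((x : ℂ) + I) ^ j / (((x ^ 2 + 1) ^ ((j : ℝ) / 2 + 1) : ℝ) : ℂ) =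
      Complex.exp (I * j * acot x) * Real.sin (acot x) ^ 2 := by
  have h_ne : x ^ 2 + 1 ≠ 0 := by positivity
  rw [Real.rpow_add_one h_ne, Complex.ofReal_mul, ← div_div, add_I_zpow_div_rpow,
    ← Complex.ofReal_pow, sin_acot_sq, add_comm (1 : ℝ), Complex.ofReal_inv, div_eq_mul_inv]

theorem add_I_sq_div (x : ℝ) :
    ((x : ℂ) + I) ^ 2 / ((x : ℂ) ^ 2 + 1) = Complex.exp (2 * I * acot x) := by
  have h := add_I_zpow_div_rpow x 2
  rw [Int.cast_ofNat, div_self two_ne_zero, Real.rpow_one] at h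
  push_cast at h
  rw [mul_comm 2 I, ← h]
  norm_cast

theorem log_cot_half_acot (x : ℝ) : Real.log (Real.cot (acot x / 2)) = Real.arsinh x := by
  have h_sqrt : √(1 + x ^ 2) ≠ 0 := by positivity
  have h_sin : Real.sin (acot x) ≠ 0 := (Real.sin_pos_of_mem_Ioo (acot_mem_Ioo x)).ne'
  rw [cot_half_eq h_sin, Real.arsinh, sin_acot, cos_acot]
  congr 1
  field_simp
  ring

theorem logBracket_acot (x : ℝ) :
    logBracket (acot x) = Real.sin (acot x) ^ 2 * (x * √(x ^ 2 + 1) + Real.arsinh x) := by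
  have h_cos : Real.cos (acot x) = Real.sin (acot x) ^ 2 * (x * √(x ^ 2 + 1)) := by
    have h_sqrt : √(1 + x ^ 2) ≠ 0 := by positivity
    rw [cos_acot, sin_acot, add_comm (x ^ 2)]
    field_simp
  rw [logBracket, log_cot_half_acot, h_cos, mul_add]

/-- The function `y ↦ (y + i) ^ k / (y ^ 2 + 1) ^ (k / 2)`, which is `exp (i k acot y)`. -/
noncomputable def rationalPhase (k : ℤ) (y : ℝ) : ℂ :=
  ((y : ℂ) + I) ^ k / (((y ^ 2 + 1) ^ ((k : ℝ) / 2) : ℝ) : ℂ)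

theorem rationalPhase_eq_exp_acot (k : ℤ) :
    rationalPhase k = fun y => Complex.exp (I * k * acot (y / 1)) := by
  ext y
  rw [rationalPhase, add_I_zpow_div_rpow, div_one]

variable {k : ℤ}

theorem hasHalfLaplacianAt_rationalPhase_series (hk : Odd k) (x : ℝ) :
    HasHalfLaplacianAt (rationalPhase k) x
      (-(2 * I / (π * (k + 2)))
        - k * ((x : ℂ) + I) ^ k / (((x ^ 2 + 1) ^ ((k : ℝ) / 2 + 1) : ℝ) : ℂ)
        + 8 * I / (π * (4 - (k : ℂ) ^ 2)) *
            ordinaryHypergeometric (1 : ℂ) (-(k : ℂ) / 2 - 1) (-(k : ℂ) / 2 + 2)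
              (((x : ℂ) + I) ^ 2 / ((x : ℂ) ^ 2 + 1))) := by
  rw [rationalPhase_eq_exp_acot]
  convert hasHalfLaplacianAt_exp_acot_series hk one_pos (congrArg acot (div_one x).symm) using 1
  rw [mul_div_assoc (k : ℂ), add_I_zpow_div_rpow_add_one, add_I_sq_div, Complex.ofReal_one,
    Complex.ofReal_sin]
  ring

theorem sum_add_I_zpow_div_rpow (σ : ℤ) (x : ℝ) (m : ℕ) :
    ∑ n ∈ Finset.range m, 8 * I * k * ((x : ℂ) + I) ^ (k - σ * (2 * (n : ℤ) + 1)) /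
        (π * (2 * n - 1) * (2 * n + 1) * (2 * n + 3) *
          (((x ^ 2 + 1) ^ (((k - σ * (2 * (n : ℤ) + 1) : ℤ) : ℝ) / 2) : ℝ) : ℂ)) =
      2 * I * k / π * Complex.exp (I * k * acot x) * ∑ n ∈ Finset.range m,
        4 * Complex.exp (-(I * σ * (2 * n + 1) * acot x)) /
          ((2 * n - 1) * (2 * n + 1) * (2 * n + 3)) := by
  rw [Finset.mul_sum]
  refine Finset.sum_congr rfl fun n _ => ?_
  have h_exp : Complex.exp (I * ((k - σ * (2 * (n : ℤ) + 1) : ℤ) : ℂ) * acot x) =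
      Complex.exp (I * k * acot x) * Complex.exp (-(I * σ * (2 * n + 1) * acot x)) := by
    rw [← Complex.exp_add]
    push_cast
    ring_nf
  rw [mul_div_mul_comm, add_I_zpow_div_rpow, h_exp, mul_assoc (π : ℂ), mul_assoc (π : ℂ)]
  generalize (2 * (n : ℂ) - 1) * (2 * n + 1) * (2 * n + 3) = D
  ring

theorem hasHalfLaplacianAt_rationalPhase_closed_form (hk : Odd k) (x : ℝ) :
    HasHalfLaplacianAt (rationalPhase k) x
      (-(2 * I * (k.sign : ℂ) / (π * ((|k| : ℤ) + 2)))
        - 2 * I * k * ((x : ℂ) + I) ^ k * ((x * √(x ^ 2 + 1) + Real.arsinh x : ℝ) : ℂ) /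
            (π * (((x ^ 2 + 1) ^ ((k : ℝ) / 2 + 1) : ℝ) : ℂ))
        - ∑ n ∈ Finset.range ((k.natAbs - 1) / 2 + 1),
            8 * I * k * ((x : ℂ) + I) ^ (k - k.sign * (2 * (n : ℤ) + 1)) /
              (π * (2 * n - 1) * (2 * n + 1) * (2 * n + 3) *
                (((x ^ 2 + 1) ^ (((k - k.sign * (2 * (n : ℤ) + 1) : ℤ) : ℝ) / 2) : ℝ) : ℂ))) := by
  rw [rationalPhase_eq_exp_acot]
  convert hasHalfLaplacianAt_exp_acot_closed_form hk one_pos (congrArg acot (div_one x).symm)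
    using 1
  have h_pow := add_I_zpow_div_rpow_add_one x k
  have h_bracket : 2 * I * k * ((x : ℂ) + I) ^ k * ((x * √(x ^ 2 + 1) + Real.arsinh x : ℝ) : ℂ) /
      (π * (((x ^ 2 + 1) ^ ((k : ℝ) / 2 + 1) : ℝ) : ℂ)) =
      2 * I * k / π * Complex.exp (I * k * acot x) * logBracket (acot x) := by
    rw [logBracket_acot, Complex.ofReal_mul, Complex.ofReal_pow]
    linear_combination
      (2 * I * k / π * ((x * √(x ^ 2 + 1) + Real.arsinh x : ℝ) : ℂ)) * h_pow
  rw [h_bracket, sum_add_I_zpow_div_rpow, Complex.ofReal_one]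
  ring

end RationalForm

end HalfLap

theorem theorem1 (k : ℤ) (hk : Odd k) :
    (∀ L : ℝ, 0 < L → ∀ s : ℝ, s ∈ Set.Ioo 0 Real.pi → ∀ x : ℝ,
      (x = L * Real.cot s ↔ s = HalfLap.acot (x / L)) ∧
      (x = L * Real.cot s →
        Summable (HalfLap.hypTerm k (Complex.exp (2 * Complex.I * s))) ∧
        HalfLap.HasHalfLaplacianAt
          (fun y : ℝ => Complex.exp (Complex.I * k * HalfLap.acot (y / L))) x
          (-(2 * Complex.I / (L * Real.pi * (k + 2)))
            - k / L * Complex.sin s ^ 2 * Complex.exp (Complex.I * k * s)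
            + 8 * Complex.I * ordinaryHypergeometric (1 : ℂ) (-(k : ℂ) / 2 - 1) (-(k : ℂ) / 2 + 2)
                (Complex.exp (2 * Complex.I * s)) / (L * Real.pi * (4 - (k : ℂ) ^ 2))) ∧
        HalfLap.HasHalfLaplacianAt
          (fun y : ℝ => Complex.exp (Complex.I * k * HalfLap.acot (y / L))) x
          (-(2 * Complex.I * (k.sign : ℂ) / (L * Real.pi * ((|k| : ℤ) + 2)))
            - 2 * Complex.I * k / (L * Real.pi) * Complex.exp (Complex.I * k * s) *
              (((Real.cos s + Real.sin s ^ 2 * Real.log (Real.cot (s / 2)) : ℝ) : ℂ)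
                + ∑ n ∈ Finset.range ((k.natAbs - 1) / 2 + 1),
                    4 * Complex.exp (-(Complex.I * (k.sign : ℂ) * (2 * n + 1) * s)) /
                      ((2 * n - 1) * (2 * n + 1) * (2 * n + 3)))))) ∧
    (∀ x : ℝ,
      Summable (HalfLap.hypTerm k (((x : ℂ) + Complex.I) ^ 2 / ((x : ℂ) ^ 2 + 1))) ∧
      HalfLap.HasHalfLaplacianAt
        (fun y : ℝ => ((y : ℂ) + Complex.I) ^ k / (((y ^ 2 + 1) ^ ((k : ℝ) / 2) : ℝ) : ℂ)) x
        (-(2 * Complex.I / (Real.pi * (k + 2)))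
          - k * ((x : ℂ) + Complex.I) ^ k / (((x ^ 2 + 1) ^ ((k : ℝ) / 2 + 1) : ℝ) : ℂ)
          + 8 * Complex.I / (Real.pi * (4 - (k : ℂ) ^ 2)) *
              ordinaryHypergeometric (1 : ℂ) (-(k : ℂ) / 2 - 1) (-(k : ℂ) / 2 + 2)
                (((x : ℂ) + Complex.I) ^ 2 / ((x : ℂ) ^ 2 + 1))) ∧
      HalfLap.HasHalfLaplacianAt
        (fun y : ℝ => ((y : ℂ) + Complex.I) ^ k / (((y ^ 2 + 1) ^ ((k : ℝ) / 2) : ℝ) : ℂ)) x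
        (-(2 * Complex.I * (k.sign : ℂ) / (Real.pi * ((|k| : ℤ) + 2)))
          - 2 * Complex.I * k * ((x : ℂ) + Complex.I) ^ k *
              ((x * Real.sqrt (x ^ 2 + 1) + Real.arsinh x : ℝ) : ℂ) /
              (Real.pi * (((x ^ 2 + 1) ^ ((k : ℝ) / 2 + 1) : ℝ) : ℂ))
          - ∑ n ∈ Finset.range ((k.natAbs - 1) / 2 + 1),
              8 * Complex.I * k * ((x : ℂ) + Complex.I) ^ (k - k.sign * (2 * (n : ℤ) + 1)) /
                (Real.pi * (2 * n - 1) * (2 * n + 1) * (2 * n + 3) *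
                  (((x ^ 2 + 1) ^ (((k - k.sign * (2 * (n : ℤ) + 1) : ℤ) : ℝ) / 2) : ℝ) : ℂ)))) := by
  refine ⟨fun L hL s hs x => ?_, fun x => ?_⟩
  · have h_iff := HalfLap.eq_mul_cot_iff (x := x) hL.ne' hs
    refine ⟨h_iff, fun hx => ⟨HalfLap.summable_hypTerm hk s, ?_, ?_⟩⟩
    · exact HalfLap.hasHalfLaplacianAt_exp_acot_series hk hL (h_iff.1 hx)
    · exact HalfLap.hasHalfLaplacianAt_exp_acot_closed_form hk hL (h_iff.1 hx)
  · refine ⟨?_, HalfLap.hasHalfLaplacianAt_rationalPhase_series hk x,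
      HalfLap.hasHalfLaplacianAt_rationalPhase_closed_form hk x⟩
    rw [HalfLap.add_I_sq_div]
    exact HalfLap.summable_hypTerm hk (HalfLap.acot x)
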